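/- **Setting.** Let $K$ be a field, $\overline K$ an algebraic closure of $K$, and let $K\subseteq L\subseteq\overline K$ be an intermediate field such that $L/K$ is separable, possibly of infinite degree. Let $N$ be the normal closure of $L/K$ in $\overline K$, put $G:=\mathrm{Gal}(N/K)$, and let $(L_i)_{i\in I}$ be the family of distinct conjugates $g(L)$, $g\in G$. Let $\Gamma$ be the groupoid with objects the fields $L_i$ and arrows $\Gamma(L_i,L_j)=\{g|_{L_i} : g\in G,\ g(L_i)=L_j\}$ from $L_i$ to $L_j$, under composition of maps. For an arrow $\sigma$, write $d(\sigma)$ and $r(\sigma)$ for its domain and range, regarded both as fields and as identity arrows; $\sigma\tau$ is defined if and only if $d(\sigma)=r(\tau)$. For all $\sigma,\tau$ with $d(\sigma)=r(\tau)$ let $\beta_{\sigma,\tau}\in r(\sigma)\setminus\{0\}$ be such that $\beta_{\sigma,d(\sigma)}=\beta_{r(\sigma),\sigma}=1$ for all $\sigma$, and $\beta_{\sigma,\tau}\,\beta_{\sigma\tau,\rho}=\sigma(\beta_{\tau,\rho})\,\beta_{\sigma,\tau\rho}$ whenever $d(\sigma)=r(\tau)$ and $d(\tau)=r(\rho)$.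 Let $(L/K,\beta)$ be the associative, not necessarily unital, ring of finite formal sums $\sum_{\sigma\in\Gamma}a_\sigma u_\sigma$ with $a_\sigma\in r(\sigma)$, with componentwise addition and with multiplication the biadditive extension of $(a u_\sigma)(b u_\tau)=a\,\sigma(b)\,\beta_{\sigma,\tau}\,u_{\sigma\tau}$ if $d(\sigma)=r(\tau)$, and $(a u_\sigma)(b u_\tau)=0$ otherwise. Let $\Delta$ be a wide subgroupoid of $\Gamma$ (that is, one containing all objects and their identities), and let $(L/K,\beta_\Delta)$ be the subring of all sums $\sum_{\sigma\in\Delta}a_\sigma u_\sigma$. An extension $R/S$ of not necessarily unital rings is called separable if there is an $R$-bimodule homomorphism $\delta:R\to R\otimes_S R$ with $\mu\circ\delta=\mathrm{id}_R$, where $\mu:R\otimes_S R\to R$, $\mu(x\otimes y)=xy$. **Corollary.** Suppose that $\Delta(L_i,L_i)=\{\mathrm{id}_{L_i}\}$ for all $i\in I$. Then the ring extension $(L/K,\beta)/(L/K,\beta_\Delta)$ is separable if and only if the group $\mathrm{Aut}_K(L)$ is finite. -/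

import Mathlib

open CategoryTheory
open scoped TensorProduct

noncomputable section

/-! ### Separable extensions of (not necessarily unital) rings -/

section Separable

variable {R : Type*} [NonUnitalRing R]

/-- The relations `(r s) ⊗ r' = r ⊗ (s r')`, for `r, r' ∈ R` and `s ∈ S`, inside `R ⊗_ℤ R`. -/
def balancedRelations (S : NonUnitalSubring R) : Submodule ℤ (R ⊗[ℤ] R) :=
  Submodule.span ℤ
    {t | ∃ r r' : R, ∃ s ∈ S, t = (r * s) ⊗ₜ[ℤ] r' - r ⊗ₜ[ℤ] (s * r')}

/-- The tensor product `R ⊗_S R` over a not necessarily unital subring `S` of `R`. -/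
abbrev BalancedTensor (S : NonUnitalSubring R) : Type _ :=
  (R ⊗[ℤ] R) ⧸ balancedRelations S

namespace BalancedTensor

variable (S : NonUnitalSubring R)

/-- The left action of `r` on `R ⊗_S R`, given by `r (x ⊗ y) = (r x) ⊗ y`. -/
def lact (r : R) : BalancedTensor S →ₗ[ℤ] BalancedTensor S :=
  (balancedRelations S).mapQ (balancedRelations S)
    ((LinearMap.mulLeft ℤ r).rTensor R) (by
      rw [balancedRelations, Submodule.span_le]
      rintro t ⟨x, y, s, hs, rfl⟩
      refine Submodule.subset_span ⟨r * x, y, s, hs, ?_⟩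
      rw [mul_assoc]
      exact map_sub ((LinearMap.mulLeft ℤ r).rTensor R) _ _)

/-- The right action of `r` on `R ⊗_S R`, given by `(x ⊗ y) r = x ⊗ (y r)`. -/
def ract (r : R) : BalancedTensor S →ₗ[ℤ] BalancedTensor S :=
  (balancedRelations S).mapQ (balancedRelations S)
    ((LinearMap.mulRight ℤ r).lTensor R) (by
      rw [balancedRelations, Submodule.span_le]
      rintro t ⟨x, y, s, hs, rfl⟩
      refine Submodule.subset_span ⟨x, y * r, s, hs, ?_⟩
      rw [← mul_assoc]
      exact map_sub ((LinearMap.mulRight ℤ r).lTensor R) _ _)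

/-- The multiplication map `R ⊗_S R → R`, `x ⊗ y ↦ x y`. -/
def mulMap : BalancedTensor S →ₗ[ℤ] R :=
  (balancedRelations S).liftQ (LinearMap.mul' ℤ R) (by
    rw [balancedRelations, Submodule.span_le]
    rintro t ⟨x, y, s, hs, rfl⟩
    refine (map_sub (LinearMap.mul' ℤ R) _ _).trans ?_
    simp [mul_assoc])

end BalancedTensor

/-- The ring extension `R/S` is separable: the multiplication map `R ⊗_S R → R` has a section
which is a homomorphism of `R`-bimodules. -/
def IsSeparableExtension (S : NonUnitalSubring R) : Prop :=
  ∃ δ : R →+ BalancedTensor S,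
    (∀ r x : R, δ (r * x) = BalancedTensor.lact S r (δ x)) ∧
    (∀ x r : R, δ (x * r) = BalancedTensor.ract S r (δ x)) ∧
    (∀ x : R, BalancedTensor.mulMap S (δ x) = x)

end Separable

/-! ### Object crossed systems and object crossed products

For arrows `τ : e ⟶ f` and `σ : f ⟶ g` the composite `σ τ` of the mathematical text is
`τ ≫ σ`. -/

/-- An object crossed system `(A, Γ, α, β)` over a groupoid `Γ`. -/
structure ObjectCrossedSystem (Γ : Type*) [Groupoid Γ] where
  A : Γ → Type*
  [ring : ∀ e, Ring (A e)]
  [nontriv : ∀ e, Nontrivial (A e)]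
  α : ∀ {e f : Γ}, (e ⟶ f) → (A e ≃+* A f)
  β : ∀ {e f g : Γ}, (f ⟶ g) → (e ⟶ f) → (A g)ˣ
  O1 : ∀ (e : Γ) (a : A e), α (𝟙 e) a = a
  O2 : ∀ {e f : Γ} (σ : e ⟶ f), β σ (𝟙 e) = 1 ∧ β (𝟙 f) σ = 1
  O3 : ∀ {e f g : Γ} (σ : f ⟶ g) (τ : e ⟶ f) (a : A e),
    α σ (α τ a) = (β σ τ : A g) * α (τ ≫ σ) a * ((β σ τ)⁻¹ : (A g)ˣ)
  O4 : ∀ {e f g h : Γ} (σ : g ⟶ h) (τ : f ⟶ g) (ρ : e ⟶ f),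
    (β σ τ : A h) * β (τ ≫ σ) ρ = α σ (β τ ρ) * β σ (ρ ≫ τ)

namespace ObjectCrossedSystem

attribute [instance] ObjectCrossedSystem.ring ObjectCrossedSystem.nontriv

/-- The set of all arrows of `Γ`; the arrow `σ : e ⟶ f` is recorded as `⟨e, f, σ⟩`. -/
abbrev Arr (Γ : Type*) [Groupoid Γ] : Type _ := Σ e f : Γ, (e ⟶ f)

variable {Γ : Type*} [Groupoid Γ] (X : ObjectCrossedSystem Γ)

/-- The object crossed product: finite formal sums `∑ a_σ u_σ` with `a_σ ∈ A_{r(σ)}`. -/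
def CrossedProduct : Type _ := Π₀ p : Arr Γ, X.A p.2.1

instance : AddCommGroup X.CrossedProduct :=
  inferInstanceAs (AddCommGroup (Π₀ p : Arr Γ, X.A p.2.1))

/-- The coefficient `a_σ` of `∑ a_σ u_σ`. -/
def coeff (x : X.CrossedProduct) (p : Arr Γ) : X.A p.2.1 := DFinsupp.toFun x p

open Classical in
/-- The element `a u_σ`, additively in `a`. -/
def single (p : Arr Γ) : X.A p.2.1 →+ X.CrossedProduct :=
  DFinsupp.singleAddHom (fun p : Arr Γ => X.A p.2.1) p

/-- The product `(a u_σ) (b u_τ) = a α_σ(b) β_{σ,τ} u_{στ}` for composable `σ`, `τ`. -/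
def compMul {e f g : Γ} (σ : f ⟶ g) (τ : e ⟶ f) : X.A g →+ X.A f →+ X.CrossedProduct :=
  AddMonoidHom.mk' (fun a =>
    AddMonoidHom.mk' (fun b => X.single ⟨e, g, τ ≫ σ⟩ (a * X.α σ b * X.β σ τ))
      (fun b b' => by rw [map_add, mul_add, add_mul, map_add]))
    (fun a a' => by
      ext b
      simp [add_mul])

open Classical in
/-- The product of `a u_σ` and `b u_τ`, which is `0` if `σ` and `τ` are not composable. -/
def homMul : (p q : Arr Γ) → X.A p.2.1 →+ X.A q.2.1 →+ X.CrossedProduct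
  | ⟨f, _, σ⟩, ⟨_, f', τ⟩ =>
    if h : f' = f then
      (match f, h, σ with
        | _, rfl, σ => X.compMul σ τ)
    else 0

open Classical in
/-- The biadditive extension of `homMul`. -/
def mulHom : X.CrossedProduct →+ X.CrossedProduct →+ X.CrossedProduct :=
  DFinsupp.liftAddHom (β := fun p : Arr Γ => X.A p.2.1) fun p =>
    AddMonoidHom.flip (DFinsupp.liftAddHom (β := fun p : Arr Γ => X.A p.2.1) fun q =>
      AddMonoidHom.flip (X.homMul p q))

instance : Mul X.CrossedProduct := ⟨fun x y => X.mulHom x y⟩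

theorem mul_def (x y : X.CrossedProduct) : x * y = X.mulHom x y := rfl

theorem single_mul_single_aux (p q : Arr Γ) (a : X.A p.2.1) (b : X.A q.2.1) :
    X.single p a * X.single q b = X.homMul p q a b := by
  classical
  have h1 := DFinsupp.liftAddHom_apply_single (β := fun p : Arr Γ => X.A p.2.1)
    (fun p => AddMonoidHom.flip (DFinsupp.liftAddHom (β := fun p : Arr Γ => X.A p.2.1) fun q =>
      AddMonoidHom.flip (X.homMul p q))) p a
  have h2 := DFinsupp.liftAddHom_apply_single (β := fun p : Arr Γ => X.A p.2.1)
    (fun q => AddMonoidHom.flip (X.homMul p q)) q b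
  have h3 := DFunLike.congr_fun h1 (X.single q b)
  have h4 := DFunLike.congr_fun h2 a
  refine Eq.trans ?_ (h3.trans (Eq.trans ?_ h4))
  · rfl
  · rfl

theorem single_mul_single {e f g : Γ} (σ : f ⟶ g) (τ : e ⟶ f) (a : X.A g) (b : X.A f) :
    X.single ⟨f, g, σ⟩ a * X.single ⟨e, f, τ⟩ b =
      X.single ⟨e, g, τ ≫ σ⟩ (a * X.α σ b * X.β σ τ) := by
  rw [single_mul_single_aux]
  simp [homMul, compMul]

theorem single_mul_single_of_ne {e f f' g : Γ} (σ : f ⟶ g) (τ : e ⟶ f') (h : f' ≠ f)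
    (a : X.A g) (b : X.A f') :
    X.single ⟨f, g, σ⟩ a * X.single ⟨e, f', τ⟩ b = 0 := by
  rw [single_mul_single_aux]
  simp [homMul, h]

@[elab_as_elim]
theorem induction_single {P : X.CrossedProduct → Prop} (x : X.CrossedProduct) (h0 : P 0)
    (ha : ∀ x y, P x → P y → P (x + y)) (hs : ∀ p a, P (X.single p a)) : P x := by
  classical
  exact DFinsupp.induction (p := P) x h0 (fun i b f _ _ hf => ha _ _ (hs i b) hf)

theorem mul_assoc_single (p q s : Arr Γ) (a : X.A p.2.1) (b : X.A q.2.1) (c : X.A s.2.1) :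
    X.single p a * X.single q b * X.single s c =
      X.single p a * (X.single q b * X.single s c) := by
  have hz : ∀ x : X.CrossedProduct, (0 : X.CrossedProduct) * x = 0 := fun x => by simp [mul_def]
  have hz' : ∀ x : X.CrossedProduct, x * (0 : X.CrossedProduct) = 0 := fun x => by simp [mul_def]
  obtain ⟨g, h, σ⟩ := p
  obtain ⟨f, g', τ⟩ := q
  obtain ⟨e, f', ρ⟩ := s
  by_cases h1 : g' = g
  · subst h1
    rw [single_mul_single]
    by_cases h2 : f' = f
    · subst h2
      rw [single_mul_single, single_mul_single, single_mul_single, Category.assoc]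
      congr 1
      have h4 := X.O4 σ τ ρ
      have h3 := X.O3 σ τ c
      simp only [map_mul, mul_assoc]
      rw [← h4, h3]
      simp [mul_assoc]
    · rw [single_mul_single_of_ne _ _ _ h2, single_mul_single_of_ne _ _ _ h2, hz']
  · rw [single_mul_single_of_ne _ _ _ h1, hz]
    by_cases h2 : f' = f
    · subst h2
      rw [single_mul_single, single_mul_single_of_ne _ _ _ h1]
    · rw [single_mul_single_of_ne _ _ _ h2, hz']

/-- The object crossed product is an associative, not necessarily unital, ring. -/
instance : NonUnitalRing X.CrossedProduct :=
  { (inferInstance : AddCommGroup X.CrossedProduct),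
    (inferInstance : Mul X.CrossedProduct) with
    left_distrib := fun x y z => by simp [mul_def]
    right_distrib := fun x y z => by simp [mul_def]
    zero_mul := fun x => by simp [mul_def]
    mul_zero := fun x => by simp [mul_def]
    mul_assoc := fun x y z => by
      have e : ∀ x y z : X.CrossedProduct,
          (x * y * z = x * (y * z)) ↔
            X.mulHom (X.mulHom x y) z = X.mulHom x (X.mulHom y z) := fun _ _ _ => Iff.rfl
      rw [e]
      induction x using induction_single with
      | h0 => simp
      | ha x x' hx hx' => simp [hx, hx']
      | hs p a =>
        induction y using induction_single with
        | h0 => simp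
        | ha y y' hy hy' => simp [hy, hy']
        | hs q b =>
          induction z using induction_single with
          | h0 => simp
          | ha z z' hz hz' => simp [hz, hz']
          | hs s c => exact X.mul_assoc_single p q s a b c }

theorem coeff_add (x y : X.CrossedProduct) (p : Arr Γ) :
    X.coeff (x + y) p = X.coeff x p + X.coeff y p := rfl

theorem coeff_single_of_ne {p q : Arr Γ} (h : p ≠ q) (a : X.A p.2.1) :
    X.coeff (X.single p a) q = 0 := by
  classical
  exact DFinsupp.single_eq_of_ne (β := fun p : Arr Γ => X.A p.2.1) (Ne.symm h)

theorem induction_supported (D : Set (Arr Γ)) {P : X.CrossedProduct → Prop}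
    (x : X.CrossedProduct) (hx : ∀ p ∉ D, X.coeff x p = 0) (h0 : P 0)
    (ha : ∀ x y, P x → P y → P (x + y)) (hs : ∀ p ∈ D, ∀ a, P (X.single p a)) : P x := by
  classical
  have hx' : (x.sum fun p a => X.single p a : X.CrossedProduct) = x :=
    DFinsupp.sum_single (β := fun p : Arr Γ => X.A p.2.1) (f := x)
  rw [← hx']
  refine Finset.sum_induction _ P (fun x y => ha x y) h0 fun p hp => ?_
  by_cases h : p ∈ D
  · exact hs p h _
  · exact absurd (hx p h) (DFinsupp.mem_support_iff.mp hp)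

/-- The subring `R_Δ` of `R = A ⋊ Γ` consisting of the sums `∑ a_σ u_σ` with `a_σ = 0` unless
`σ ∈ Δ`. For `Δ` wide, this is the object crossed product of the restriction of `(A, Γ, α, β)`
to `Δ`. -/
def subringOf (Δ : Subgroupoid Γ) : NonUnitalSubring X.CrossedProduct where
  carrier := {x | ∀ p : Arr Γ, p.2.2 ∉ Δ.arrows p.1 p.2.1 → X.coeff x p = 0}
  zero_mem' := fun p _ => rfl
  add_mem' := fun {x y} hx hy p hp => by rw [coeff_add, hx p hp, hy p hp, add_zero]
  neg_mem' := fun {x} hx p hp => by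
    have : X.coeff (-x) p = - X.coeff x p := rfl
    rw [this, hx p hp, neg_zero]
  mul_mem' := fun {x y} hx hy => by
    refine X.induction_supported {p : Arr Γ | p.2.2 ∈ Δ.arrows p.1 p.2.1}
      (P := fun x => ∀ p : Arr Γ, p.2.2 ∉ Δ.arrows p.1 p.2.1 → X.coeff (x * y) p = 0)
      x hx (fun p _ => by rw [zero_mul]; rfl)
      (fun u v hu hv p hp => by rw [add_mul, coeff_add, hu p hp, hv p hp, add_zero]) ?_
    rintro ⟨f, g, σ⟩ hσ a
    refine X.induction_supported {p : Arr Γ | p.2.2 ∈ Δ.arrows p.1 p.2.1}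
      (P := fun y => ∀ p : Arr Γ, p.2.2 ∉ Δ.arrows p.1 p.2.1 →
        X.coeff (X.single ⟨f, g, σ⟩ a * y) p = 0)
      y hy (fun p _ => by rw [mul_zero]; rfl)
      (fun u v hu hv p hp => by rw [mul_add, coeff_add, hu p hp, hv p hp, add_zero]) ?_
    rintro ⟨e, f', τ⟩ hτ b p hp
    by_cases h : f' = f
    · subst h
      rw [single_mul_single]
      refine X.coeff_single_of_ne ?_ _
      rintro rfl
      exact hp (Δ.mul hτ hσ)
    · rw [single_mul_single_of_ne _ _ _ h]
      rfl

end ObjectCrossedSystem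

/-! ### The groupoid of conjugate fields -/

section Conjugates

variable {K N : Type*} [Field K] [Field N] [Algebra K N]

/-- The set of (distinct) conjugates `g(L)`, `g ∈ Gal(N/K)`, of an intermediate field `L` of
`N/K`. -/
def ConjField (L : IntermediateField K N) : Type _ :=
  {M : IntermediateField K N // ∃ g : N ≃ₐ[K] N, M = L.map (g : N →ₐ[K] N)}

variable {L : IntermediateField K N}

/-- The arrows `M → M'`: the restrictions `g|_M` with `g ∈ Gal(N/K)` and `g(M) = M'`. -/
def ConjField.Hom (M M' : ConjField L) : Type _ :=
  {s : M.1 ≃ₐ[K] M'.1 // ∃ g : N ≃ₐ[K] N,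
    M.1.map (g : N →ₐ[K] N) = M'.1 ∧ ∀ x : M.1, (s x : N) = g x}

/-- The conjugate fields of `L` form a groupoid under composition of maps. -/
instance : Groupoid (ConjField L) where
  Hom M M' := ConjField.Hom M M'
  id M := ⟨AlgEquiv.refl, AlgEquiv.refl, IntermediateField.map_id _, fun _ => rfl⟩
  comp {M M' M''} τ σ := ⟨τ.1.trans σ.1, by
    obtain ⟨g, hg, hg'⟩ := τ.2
    obtain ⟨k, hk, hk'⟩ := σ.2
    refine ⟨g.trans k, ?_, fun x => ?_⟩
    · rw [← hk, ← hg, IntermediateField.map_map]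
      rfl
    · simp [hk', hg']⟩
  inv {M M'} σ := ⟨σ.1.symm, by
    obtain ⟨g, hg, hg'⟩ := σ.2
    refine ⟨g.symm, ?_, fun x => ?_⟩
    · rw [← hg, IntermediateField.map_map]
      convert IntermediateField.map_id _
      ext x
      simp
    · obtain ⟨y, rfl⟩ := σ.1.surjective x
      simp [hg']⟩
  id_comp _ := rfl
  comp_id _ := rfl
  assoc _ _ _ := rfl
  inv_comp σ := Subtype.ext (AlgEquiv.symm_trans_self σ.1)
  comp_inv σ := Subtype.ext (AlgEquiv.self_trans_symm σ.1)

variable (L) in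
/-- A family `β_{σ,τ} ∈ L_{r(σ)} \ {0}`, indexed by the composable pairs of arrows of the
groupoid of conjugate fields of `L`, satisfying (O2) and (O4) for `α_σ = σ`. -/
structure ConjFactorSet where
  β : ∀ {e f g : ConjField L}, (f ⟶ g) → (e ⟶ f) → (g.1)ˣ
  O2 : ∀ {e f : ConjField L} (σ : e ⟶ f), β σ (𝟙 e) = 1 ∧ β (𝟙 f) σ = 1
  O4 : ∀ {e f g h : ConjField L} (σ : g ⟶ h) (τ : f ⟶ g) (ρ : e ⟶ f),
    (β σ τ : h.1) * β (τ ≫ σ) ρ = σ.1 (β τ ρ : g.1) * β σ (ρ ≫ τ)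

/-- The object crossed system of the conjugate fields of `L`, with `α_σ = σ`. -/
def ConjFactorSet.system (b : ConjFactorSet L) : ObjectCrossedSystem (ConjField L) where
  A M := M.1
  α σ := (σ.1 : _ ≃ₐ[K] _).toRingEquiv
  β σ τ := b.β σ τ
  O1 _ _ := rfl
  O2 := b.O2
  O3 σ τ a := by
    rw [mul_comm, ← mul_assoc, Units.inv_mul, one_mul]
    rfl
  O4 := b.O4

end Conjugates

end

/-! Composites are written as in the mathematical text, so `τ ≫ σ` is `στ`.

Necessity: fix an object `e` and put `t = δ(u_e)`. Since `δ` is a bimodule map, `u_g t = δ(u_g) = t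
u_g` for every loop `g` at `e`. Grade `R ⊗ R` over `R_Δ` by sending `a u_σ ⊗ y` to the coefficient
of `a u_σ y` at a chosen loop, placed at the coset `σΔ` (`cosetMap`). The function on cosets
attached to `t` satisfies `f(gσΔ) = α_g(f(σΔ))`, and its values sum to the coefficient `1` of `μ(t)
= u_e`. So it is nonzero with finite support, and the support contains a whole family `gσΔ`. These
cosets are distinct when `Δ` has trivial isotropy, so there are finitely many `g`.

Sufficiency: the loops at `L` are then finitely many distinct automorphisms of a field, so
independence of characters gives `c` of trace `1`. The elements `x_f = ∑ u_τ c ⊗ u_τ⁻¹`, over `τ : e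
⟶ f`, satisfy `a u_σ x_f = x_g a u_σ` for `σ : f ⟶ g`, and `μ(x_f) = u_f`; hence `a u_σ ↦ a u_σ
x_{d(σ)}` is a bimodule section.

The two halves meet the statement through `ConjField.loopEquiv`: by normality, the loops at `L` form
`Aut_K(L)`. -/

noncomputable section

/-! ### Bimodule calculus in the balanced tensor product -/

namespace BalancedTensor

variable {R : Type*} [NonUnitalRing R] (S : NonUnitalSubring R)

/-- The class of `x ⊗ y` in `R ⊗_S R`. -/
def tmul (x y : R) : BalancedTensor S := (balancedRelations S).mkQ (x ⊗ₜ[ℤ] y)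

theorem lact_tmul (r x y : R) : lact S r (tmul S x y) = tmul S (r * x) y := rfl

theorem ract_tmul (r x y : R) : ract S r (tmul S x y) = tmul S x (y * r) := rfl

theorem mulMap_tmul (x y : R) : mulMap S (tmul S x y) = x * y := rfl

theorem tmul_add (x y y' : R) : tmul S x (y + y') = tmul S x y + tmul S x y' := by
  simp only [tmul, TensorProduct.tmul_add, map_add]

theorem add_tmul (x x' y : R) : tmul S (x + x') y = tmul S x y + tmul S x' y := by
  simp only [tmul, TensorProduct.add_tmul, map_add]

theorem tmul_mul {s : R} (hs : s ∈ S) (x y : R) : tmul S (x * s) y = tmul S x (s * y) :=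
  (Submodule.Quotient.eq _).2 (Submodule.subset_span ⟨x, y, s, hs, rfl⟩)

@[elab_as_elim]
theorem induction_on {P : BalancedTensor S → Prop} (t : BalancedTensor S) (h0 : P 0)
    (ha : ∀ t t', P t → P t' → P (t + t')) (ht : ∀ x y, P (tmul S x y)) : P t := by
  obtain ⟨t, rfl⟩ := (balancedRelations S).mkQ_surjective t
  induction t using TensorProduct.induction_on with
  | zero => simpa using h0
  | tmul x y => exact ht x y
  | add t t' h h' => simpa using ha _ _ h h'

theorem lact_add (r r' : R) (t : BalancedTensor S) :
    lact S (r + r') t = lact S r t + lact S r' t := by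
  induction t using induction_on with
  | h0 => simp
  | ha t t' h h' => simp only [map_add, h, h']; abel
  | ht x y => simp only [lact_tmul, add_mul, add_tmul]

theorem ract_add (r r' : R) (t : BalancedTensor S) :
    ract S (r + r') t = ract S r t + ract S r' t := by
  induction t using induction_on with
  | h0 => simp
  | ha t t' h h' => simp only [map_add, h, h']; abel
  | ht x y => simp only [ract_tmul, mul_add, tmul_add]

theorem lact_zero (t : BalancedTensor S) : lact S 0 t = 0 := by
  simpa using lact_add S 0 0 t

theorem ract_zero (t : BalancedTensor S) : ract S 0 t = 0 := by
  simpa using ract_add S 0 0 t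

theorem lact_mul (r r' : R) (t : BalancedTensor S) :
    lact S (r * r') t = lact S r (lact S r' t) := by
  induction t using induction_on with
  | h0 => simp
  | ha t t' h h' => simp only [map_add, h, h']
  | ht x y => simp only [lact_tmul, mul_assoc]

theorem ract_mul (r r' : R) (t : BalancedTensor S) :
    ract S (r * r') t = ract S r' (ract S r t) := by
  induction t using induction_on with
  | h0 => simp
  | ha t t' h h' => simp only [map_add, h, h']
  | ht x y => simp only [ract_tmul, mul_assoc]

theorem mulMap_lact (r : R) (t : BalancedTensor S) : mulMap S (lact S r t) = r * mulMap S t := by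
  induction t using induction_on with
  | h0 => simp
  | ha t t' h h' => simp only [map_add, h, h', mul_add]
  | ht x y => simp only [lact_tmul, mulMap_tmul, mul_assoc]

/-- The additive map out of `R ⊗_S R` given by an `S`-balanced biadditive map. -/
def lift {B : Type*} [AddCommGroup B] (w : R →+ R →+ B)
    (hw : ∀ x y, ∀ s ∈ S, w (x * s) y = w x (s * y)) : BalancedTensor S →ₗ[ℤ] B :=
  (balancedRelations S).liftQ
    (TensorProduct.liftAddHom w fun n x y => by simp).toIntLinearMap (by
      rw [balancedRelations, Submodule.span_le]
      rintro t ⟨x, y, s, hs, rfl⟩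
      simp [hw x y s hs])

end BalancedTensor

/-! ### Monomials and coefficients in the crossed product -/

namespace ObjectCrossedSystem

variable {Γ : Type*} [Groupoid Γ] (X : ObjectCrossedSystem Γ)

/-- The element `a u_σ` for an arrow `σ : e ⟶ f`. -/
def monomial {e f : Γ} (σ : e ⟶ f) (a : X.A f) : X.CrossedProduct := X.single ⟨e, f, σ⟩ a

theorem monomial_mul {e f g : Γ} (σ : f ⟶ g) (τ : e ⟶ f) (a : X.A g) (b : X.A f) :
    X.monomial σ a * X.monomial τ b = X.monomial (τ ≫ σ) (a * X.α σ b * X.β σ τ) :=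
  X.single_mul_single σ τ a b

theorem monomial_mul_of_ne {e f f' g : Γ} (σ : f ⟶ g) (τ : e ⟶ f') (h : f' ≠ f)
    (a : X.A g) (b : X.A f') : X.monomial σ a * X.monomial τ b = 0 :=
  X.single_mul_single_of_ne σ τ h a b

@[elab_as_elim]
theorem induction_monomial {P : X.CrossedProduct → Prop} (x : X.CrossedProduct) (h0 : P 0)
    (ha : ∀ x y, P x → P y → P (x + y))
    (hs : ∀ (e f : Γ) (σ : e ⟶ f) (a : X.A f), P (X.monomial σ a)) : P x :=
  X.induction_single x h0 ha fun p a => hs p.1 p.2.1 p.2.2 a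

theorem monomial_one_mul {e f g : Γ} (σ : f ⟶ g) (τ : e ⟶ f) (b : X.A f) :
    X.monomial σ 1 * X.monomial τ b = X.monomial (τ ≫ σ) (X.α σ b * X.β σ τ) := by
  rw [monomial_mul, one_mul]

theorem id_mul_monomial {f g : Γ} (σ : f ⟶ g) (a : X.A g) :
    X.monomial (𝟙 g) 1 * X.monomial σ a = X.monomial σ a := by
  rw [monomial_mul, (X.O2 σ).2, X.O1, Category.comp_id]; simp

theorem monomial_mul_id {f g : Γ} (σ : f ⟶ g) (a : X.A g) (b : X.A f) :
    X.monomial σ a * X.monomial (𝟙 f) b = X.monomial σ (a * X.α σ b) := by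
  rw [monomial_mul, (X.O2 σ).1, Category.id_comp]; simp

/-- The coefficient at the arrow `h`, as an additive map. -/
def coeffHom {e f : Γ} (h : e ⟶ f) : X.CrossedProduct →+ X.A f :=
  AddMonoidHom.mk' (fun x => X.coeff x ⟨e, f, h⟩) fun x y => X.coeff_add x y _

theorem coeffHom_monomial_self {e f : Γ} (h : e ⟶ f) (a : X.A f) :
    X.coeffHom h (X.monomial h a) = a := by
  classical
  exact DFinsupp.single_eq_same (β := fun p : Arr Γ => X.A p.2.1)

theorem coeffHom_monomial_of_ne {e f e' f' : Γ} (h : e ⟶ f) (σ : e' ⟶ f') (a : X.A f')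
    (hne : (⟨e', f', σ⟩ : Arr Γ) ≠ ⟨e, f, h⟩) : X.coeffHom h (X.monomial σ a) = 0 :=
  X.coeff_single_of_ne hne a

/-- Every arrow occurring in `a u_σ y` has range `r(σ)`. -/
theorem coeffHom_monomial_mul_of_ne {e f e' f' : Γ} (h : e ⟶ f) (σ : e' ⟶ f') (a : X.A f')
    (hne : f' ≠ f) (y : X.CrossedProduct) : X.coeffHom h (X.monomial σ a * y) = 0 := by
  induction y using induction_monomial with
  | h0 => simp
  | ha x y hx hy => rw [mul_add, map_add, hx, hy, add_zero]
  | hs i j τ b =>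
    by_cases hj : j = e'
    · subst hj
      rw [monomial_mul]
      refine X.coeffHom_monomial_of_ne _ _ _ fun H => ?_
      simp only [Sigma.mk.injEq] at H
      obtain ⟨rfl, H⟩ := H
      rw [heq_eq_eq, Sigma.mk.injEq] at H
      exact hne H.1
    · rw [X.monomial_mul_of_ne _ _ hj, map_zero]

/-- By cancellation `gτ = g` only for `τ` the identity, where the factor `β` is `1`. -/
theorem coeffHom_loop_mul {e : Γ} (g : e ⟶ e) (z : X.CrossedProduct) :
    X.coeffHom g (X.monomial g 1 * z) = X.α g (X.coeffHom (𝟙 e) z) := by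
  induction z using induction_monomial with
  | h0 => simp
  | ha x y hx hy => rw [mul_add, map_add, hx, hy, map_add, map_add]
  | hs i j τ b =>
    by_cases hj : j = e
    · subst hj
      by_cases hi : (⟨i, j, τ⟩ : Arr Γ) = ⟨j, j, 𝟙 j⟩
      · simp only [Sigma.mk.injEq] at hi
        obtain ⟨rfl, hi⟩ := hi
        simp only [heq_eq_eq, Sigma.mk.injEq, true_and] at hi
        subst hi
        rw [monomial_mul_id, coeffHom_monomial_self, coeffHom_monomial_self, one_mul]
      · rw [monomial_mul, X.coeffHom_monomial_of_ne _ _ _ hi, map_zero]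
        refine X.coeffHom_monomial_of_ne _ _ _ fun H => hi ?_
        simp only [Sigma.mk.injEq] at H
        obtain ⟨rfl, H⟩ := H
        simp only [heq_eq_eq, Sigma.mk.injEq, true_and] at H
        rw [(cancel_mono g).1 (H.trans (Category.id_comp g).symm)]
    · rw [X.monomial_mul_of_ne _ _ hj, X.coeffHom_monomial_of_ne, map_zero, map_zero]
      intro H
      simp only [Sigma.mk.injEq] at H
      obtain ⟨rfl, H⟩ := H
      rw [heq_eq_eq, Sigma.mk.injEq] at H
      exact hj H.1

/-- The same cancellation on the right; no `α_g` appears because coefficients stand on the left. -/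
theorem coeffHom_mul_loop {e : Γ} (g : e ⟶ e) (z : X.CrossedProduct) :
    X.coeffHom g (z * X.monomial g 1) = X.coeffHom (𝟙 e) z := by
  induction z using induction_monomial with
  | h0 => simp
  | ha x y hx hy => rw [add_mul, map_add, hx, hy, map_add]
  | hs i j τ b =>
    by_cases hi : i = e
    · subst hi
      by_cases hj : (⟨i, j, τ⟩ : Arr Γ) = ⟨i, i, 𝟙 i⟩
      · simp only [Sigma.mk.injEq, heq_eq_eq, true_and] at hj
        obtain ⟨rfl, hj⟩ := hj
        rw [heq_eq_eq] at hj
        subst hj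
        rw [monomial_mul, (X.O2 g).2, Category.comp_id, coeffHom_monomial_self,
          coeffHom_monomial_self]
        simp
      · rw [monomial_mul, X.coeffHom_monomial_of_ne _ _ _ hj]
        refine X.coeffHom_monomial_of_ne _ _ _ fun H => hj ?_
        simp only [Sigma.mk.injEq, heq_eq_eq, true_and] at H
        obtain ⟨rfl, H⟩ := H
        rw [heq_eq_eq] at H
        rw [(cancel_epi g).1 (H.trans (Category.comp_id g).symm)]
    · rw [X.monomial_mul_of_ne _ _ (Ne.symm hi), X.coeffHom_monomial_of_ne, map_zero]
      intro H
      simp only [Sigma.mk.injEq] at H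
      exact hi H.1

/-! ### Necessity: grading the tensor product by cosets of `Δ` -/

section Coset

variable (Δ : Subgroupoid Γ)

/-- The coset `σ Δ` of an arrow `σ`. -/
def coset {e f : Γ} (σ : e ⟶ f) : Set (Arr Γ) :=
  {q | ∃ (e' : Γ) (d : e' ⟶ e), d ∈ Δ.arrows e' e ∧ q = ⟨e', f, d ≫ σ⟩}

variable {Δ}

theorem coset_comp {e f g : Γ} {d : e ⟶ f} (hd : d ∈ Δ.arrows e f) (σ : f ⟶ g) :
    coset Δ (d ≫ σ) = coset Δ σ := by
  ext q
  constructor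
  · rintro ⟨e', c, hc, rfl⟩
    exact ⟨e', c ≫ d, Δ.mul hc hd, by rw [Category.assoc]⟩
  · rintro ⟨e', c, hc, rfl⟩
    exact ⟨e', c ≫ Groupoid.inv d, Δ.mul hc (Δ.inv hd), by simp⟩

theorem coset_eq_iff (hΔ : Δ.IsWide) {e e' f : Γ} (σ : e ⟶ f) (σ' : e' ⟶ f) :
    coset Δ σ = coset Δ σ' ↔ σ ≫ Groupoid.inv σ' ∈ Δ.arrows e e' := by
  constructor
  · intro h
    have : (⟨e, f, σ⟩ : Arr Γ) ∈ coset Δ σ := ⟨e, 𝟙 e, hΔ.wide e, by simp⟩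
    rw [h] at this
    obtain ⟨e'', d, hd, H⟩ := this
    simp only [Sigma.mk.injEq] at H
    obtain ⟨rfl, H⟩ := H
    simp only [heq_eq_eq, Sigma.mk.injEq, true_and] at H
    subst H
    simpa using hd
  · intro h
    rw [← coset_comp h σ']
    simp

variable (Δ)

/-- The biadditive map sending `(a u_σ, y)` to the coefficient of `a u_σ y` at `h`, placed at the
coset `σ Δ`. -/
def cosetPairing {e : Γ} (h : e ⟶ e) :
    X.CrossedProduct →+ X.CrossedProduct →+ (Set (Arr Γ) →₀ X.A e) := by
  classical
  exact DFinsupp.liftAddHom (β := fun p : Arr Γ => X.A p.2.1) fun p =>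
    AddMonoidHom.mk' (fun a => ((Finsupp.singleAddHom (coset Δ p.2.2)).comp (X.coeffHom h)).comp
      (AddMonoidHom.mulLeft (X.single p a))) fun a a' => by
        ext1 y
        simp [add_mul]

theorem cosetPairing_monomial {e : Γ} (h : e ⟶ e) {i j : Γ} (σ : i ⟶ j) (a : X.A j)
    (y : X.CrossedProduct) :
    X.cosetPairing Δ h (X.monomial σ a) y =
      Finsupp.single (coset Δ σ) (X.coeffHom h (X.monomial σ a * y)) := by
  classical
  exact DFunLike.congr_fun
    (DFinsupp.liftAddHom_apply_single (β := fun p : Arr Γ => X.A p.2.1) _ ⟨i, j, σ⟩ a) y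

/-- For `d` in `Δ`, the arrows `σ` and `σd` have the same coset, and the coefficient depends only on
the product. -/
theorem cosetPairing_mul {e : Γ} (h : e ⟶ e) (x y : X.CrossedProduct) :
    ∀ s ∈ X.subringOf Δ, X.cosetPairing Δ h (x * s) y = X.cosetPairing Δ h x (s * y) := by
  intro s hs
  induction x using induction_monomial with
  | h0 => simp
  | ha x x' hx hx' => rw [add_mul, map_add, map_add, AddMonoidHom.add_apply, hx, hx']; rfl
  | hs i j σ a =>
    refine X.induction_supported {p : Arr Γ | p.2.2 ∈ Δ.arrows p.1 p.2.1} (P := fun s =>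
      X.cosetPairing Δ h (X.monomial σ a * s) y = X.cosetPairing Δ h (X.monomial σ a) (s * y))
      s hs (by simp) (fun s s' h1 h2 => ?_) ?_
    · rw [mul_add, map_add, AddMonoidHom.add_apply, h1, h2, add_mul, map_add]
    · rintro ⟨i', j', d⟩ hd b
      change X.cosetPairing Δ h (X.monomial σ a * X.monomial d b) y =
        X.cosetPairing Δ h (X.monomial σ a) (X.monomial d b * y)
      rw [cosetPairing_monomial, ← mul_assoc]
      by_cases hj : j' = i
      · subst hj
        rw [monomial_mul, cosetPairing_monomial, coset_comp hd]
      · simp [X.monomial_mul_of_ne _ _ hj]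

/-- The map `R ⊗_{R_Δ} R → ⨁_{σ Δ} A_e` induced by `cosetPairing`. -/
def cosetMap {e : Γ} (h : e ⟶ e) :
    BalancedTensor (X.subringOf Δ) →ₗ[ℤ] (Set (Arr Γ) →₀ X.A e) :=
  BalancedTensor.lift _ (X.cosetPairing Δ h) (X.cosetPairing_mul Δ h)

theorem cosetMap_tmul {e : Γ} (h : e ⟶ e) (x y : X.CrossedProduct) :
    X.cosetMap Δ h (BalancedTensor.tmul _ x y) = X.cosetPairing Δ h x y := rfl

/-- To prove an additive property of the elements of `R ⊗_{R_Δ} R`, it is enough to treat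
the elements `a u_σ ⊗ y`. -/
@[elab_as_elim]
theorem balancedTensor_induction {P : BalancedTensor (X.subringOf Δ) → Prop}
    (t : BalancedTensor (X.subringOf Δ)) (h0 : P 0)
    (ha : ∀ t t', P t → P t' → P (t + t'))
    (ht : ∀ (i j : Γ) (σ : i ⟶ j) (a : X.A j) (y : X.CrossedProduct),
      P (BalancedTensor.tmul _ (X.monomial σ a) y)) : P t := by
  induction t using BalancedTensor.induction_on with
  | h0 => exact h0
  | ha t t' h h' => exact ha t t' h h'
  | ht x y =>
    induction x using induction_monomial with
    | h0 => simpa [BalancedTensor.tmul] using h0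
    | ha x x' hx hx' => rw [BalancedTensor.add_tmul]; exact ha _ _ hx hx'
    | hs i j σ a => exact ht i j σ a y

/-- Forgetting the coset labels recovers a coefficient of `μ(t)`; this shows that the graded image
of `δ(u_e)` is nonzero. -/
theorem sum_cosetMap {e : Γ} (h : e ⟶ e) (t : BalancedTensor (X.subringOf Δ)) :
    Finsupp.liftAddHom (fun _ => AddMonoidHom.id (X.A e)) (X.cosetMap Δ h t) =
      X.coeffHom h (BalancedTensor.mulMap _ t) := by
  induction t using balancedTensor_induction with
  | h0 => simp
  | ha t t' h h' => simp only [map_add, h, h']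
  | ht i j σ a y =>
    rw [cosetMap_tmul, cosetPairing_monomial, BalancedTensor.mulMap_tmul,
      Finsupp.liftAddHom_apply_single, AddMonoidHom.id_apply]

theorem exists_coset_of_cosetMap_ne_zero {e : Γ} (h : e ⟶ e)
    (t : BalancedTensor (X.subringOf Δ)) (C : Set (Arr Γ)) (hC : X.cosetMap Δ h t C ≠ 0) :
    ∃ (i : Γ) (σ : i ⟶ e), C = coset Δ σ := by
  contrapose! hC
  induction t using balancedTensor_induction with
  | h0 => simp
  | ha t t' h h' => rw [map_add, Finsupp.add_apply, h, h', add_zero]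
  | ht i j σ a y =>
    rw [cosetMap_tmul, cosetPairing_monomial]
    by_cases hj : j = e
    · subst hj
      exact Finsupp.single_eq_of_ne (hC i σ)
    · rw [X.coeffHom_monomial_mul_of_ne _ _ _ hj, Finsupp.single_zero, Finsupp.zero_apply]

/-- Left multiplication by `u_g` permutes the cosets with range `e` and twists values by `α_g`.
Terms `a u_τ ⊗ y` with `r(τ) ≠ e` vanish on both sides. -/
theorem cosetMap_lact (hΔ : Δ.IsWide) {e i : Γ} (g : e ⟶ e) (σ : i ⟶ e)
    (t : BalancedTensor (X.subringOf Δ)) :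
    X.cosetMap Δ g (BalancedTensor.lact _ (X.monomial g 1) t) (coset Δ (σ ≫ g)) =
      X.α g (X.cosetMap Δ (𝟙 e) t (coset Δ σ)) := by
  induction t using balancedTensor_induction with
  | h0 => simp
  | ha t t' h h' => simp only [map_add, Finsupp.add_apply, h, h']
  | ht i' j τ a y =>
    rw [BalancedTensor.lact_tmul, cosetMap_tmul, cosetMap_tmul, cosetPairing_monomial]
    by_cases hj : j = e
    · subst hj
      rw [X.monomial_one_mul, cosetPairing_monomial, ← X.monomial_one_mul, mul_assoc,
        coeffHom_loop_mul]
      have key : coset Δ (τ ≫ g) = coset Δ (σ ≫ g) ↔ coset Δ τ = coset Δ σ := by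
        rw [coset_eq_iff hΔ, coset_eq_iff hΔ]
        simp
      by_cases hτ : coset Δ τ = coset Δ σ
      · rw [key.2 hτ, hτ, Finsupp.single_eq_same, Finsupp.single_eq_same]
      · rw [Finsupp.single_eq_of_ne (Ne.symm hτ), map_zero,
          Finsupp.single_eq_of_ne (Ne.symm (mt key.1 hτ))]
    · rw [X.monomial_mul_of_ne _ _ hj, X.coeffHom_monomial_mul_of_ne _ _ _ hj]
      simp

/-- Right multiplication leaves the coset of the left tensor factor alone and only moves the
inspected arrow from the identity to `g`. -/
theorem cosetMap_ract {e : Γ} (g : e ⟶ e) (t : BalancedTensor (X.subringOf Δ)) :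
    X.cosetMap Δ g (BalancedTensor.ract _ (X.monomial g 1) t) = X.cosetMap Δ (𝟙 e) t := by
  induction t using balancedTensor_induction with
  | h0 => simp
  | ha t t' h h' => simp only [map_add, h, h']
  | ht i' j τ a y =>
    rw [BalancedTensor.ract_tmul, cosetMap_tmul, cosetMap_tmul, cosetPairing_monomial,
      cosetPairing_monomial, ← mul_assoc, coeffHom_mul_loop]

/-- If `R/R_Δ` is separable and `Δ` has trivial isotropy, then the isotropy groups of `Γ` are
finite. -/
theorem finite_isotropy_of_isSeparableExtension (hΔ : Δ.IsWide)
    (htriv : ∀ e, Δ.arrows e e = {𝟙 e})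
    (hsep : IsSeparableExtension (X.subringOf Δ)) (e : Γ) : Finite (e ⟶ e) := by
  obtain ⟨δ, hl, hr, hm⟩ := hsep
  set t := δ (X.monomial (𝟙 e) 1)
  -- Both sides are read off from `u_g t = δ(u_g) = t u_g`.
  have hinv : ∀ (g : e ⟶ e) (i : Γ) (σ : i ⟶ e),
      X.cosetMap Δ (𝟙 e) t (coset Δ (σ ≫ g)) = X.α g (X.cosetMap Δ (𝟙 e) t (coset Δ σ)) := by
    intro g i σ
    rw [← X.cosetMap_lact Δ hΔ g σ t, ← X.cosetMap_ract Δ g t, ← hl, ← hr, id_mul_monomial,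
      monomial_mul_id, map_one, one_mul]
  have hne : X.cosetMap Δ (𝟙 e) t ≠ 0 := by
    intro h0
    have := X.sum_cosetMap Δ (𝟙 e) t
    rw [h0, map_zero, hm, coeffHom_monomial_self] at this
    exact zero_ne_one this
  obtain ⟨C, hC⟩ := DFunLike.ne_iff.1 hne
  obtain ⟨i, σ, rfl⟩ := X.exists_coset_of_cosetMap_ne_zero Δ _ t C hC
  -- The support is stable under `σΔ ↦ gσΔ`, since `α_g` is injective.
  refine Finite.of_injective (β := (X.cosetMap Δ (𝟙 e) t).support)
    (fun g => ⟨coset Δ (σ ≫ g), ?_⟩) fun g g' hg => ?_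
  · rw [Finsupp.mem_support_iff, hinv]
    simpa using hC
  -- Equal cosets put the loop `(g'σ)⁻¹gσ` at `d(σ)` into `Δ`, so it is an identity.
  · have := (coset_eq_iff hΔ _ _).1 (Subtype.ext_iff.1 hg)
    rw [htriv, Set.mem_singleton_iff] at this
    rw [← cancel_epi σ]
    simpa using congrArg (· ≫ σ ≫ g') this

end Coset

/-! ### Sufficiency: inverses of monomials and central coefficients -/

theorem finite_hom_of_finite_isotropy (e f : Γ) [Finite (e ⟶ e)] :
    Finite (e ⟶ f) := by
  rcases isEmpty_or_nonempty (e ⟶ f) with h | ⟨⟨ρ⟩⟩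
  · infer_instance
  · refine Finite.of_injective (fun τ : e ⟶ f => τ ≫ Groupoid.inv ρ) fun τ τ' h => ?_
    simpa using congrArg (· ≫ ρ) h

/-- The element `u_τ⁻¹`, a two-sided inverse of `u_τ`. -/
def monomialInv {e f : Γ} (τ : e ⟶ f) : X.CrossedProduct :=
  X.monomial (Groupoid.inv τ) ((X.β (Groupoid.inv τ) τ)⁻¹ : (X.A e)ˣ)

theorem monomialInv_mul_monomial {e f : Γ} (τ : e ⟶ f) :
    X.monomialInv τ * X.monomial τ 1 = X.monomial (𝟙 e) 1 := by
  rw [monomialInv, monomial_mul, map_one, mul_one, Units.inv_mul, Groupoid.comp_inv]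

/-- The cocycle identity for `(τ, τ⁻¹, τ)`, after normalisation; it makes the left inverse of `u_τ`
also a right inverse. -/
theorem β_inv_right {e f : Γ} (τ : e ⟶ f) :
    (X.β τ (Groupoid.inv τ) : X.A f) = X.α τ (X.β (Groupoid.inv τ) τ) := by
  have h := X.O4 τ (Groupoid.inv τ) τ
  rw [Groupoid.inv_comp, Groupoid.comp_inv, (X.O2 τ).1, (X.O2 τ).2] at h
  simpa using h

theorem monomial_mul_monomialInv {e f : Γ} (τ : e ⟶ f) (a : X.A f) :
    X.monomial τ a * X.monomialInv τ = X.monomial (𝟙 f) a := by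
  rw [monomialInv, monomial_mul, β_inv_right, mul_assoc, ← map_mul, Units.inv_mul, map_one,
    mul_one, Groupoid.inv_comp]

theorem id_mul_monomialInv {e f : Γ} (τ : e ⟶ f) :
    X.monomial (𝟙 e) 1 * X.monomialInv τ = X.monomialInv τ :=
  X.id_mul_monomial _ _

theorem α_mem_center {e f : Γ} (τ : e ⟶ f) {c : X.A e} (hc : c ∈ Set.center (X.A e)) :
    X.α τ c ∈ Set.center (X.A f) := by
  rw [Semigroup.mem_center_iff] at hc ⊢
  intro a
  obtain ⟨a, rfl⟩ := (X.α τ).surjective a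
  rw [← map_mul, hc, map_mul]

/-- `α` is functorial up to conjugation by `β`, which is invisible on the centre. -/
theorem α_α_of_mem_center {e f g : Γ} (σ : f ⟶ g) (τ : e ⟶ f) {c : X.A e}
    (hc : c ∈ Set.center (X.A e)) : X.α σ (X.α τ c) = X.α (τ ≫ σ) c := by
  rw [X.O3, (Semigroup.mem_center_iff.1 (X.α_mem_center (τ ≫ σ) hc)), mul_assoc,
    Units.mul_inv, mul_one]

/-- Multiplied on the left by `u_{στ}`, this becomes `a u_σ u_τ = a β_{σ,τ} u_{στ}` times `u_τ⁻¹`.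
It carries a monomial through the right tensor factor of `casimir`. -/
theorem monomial_mul_monomialInv_comp {e f g : Γ} (σ : f ⟶ g) (τ : e ⟶ f) (a : X.A g) :
    X.monomial (𝟙 e) ((X.α (τ ≫ σ)).symm (a * X.β σ τ)) * X.monomialInv τ =
      X.monomialInv (τ ≫ σ) * X.monomial σ a := by
  -- `u_{στ}` is invertible only locally, so it cancels between elements fixed by `u_e` on the left.
  have cancel : ∀ y z : X.CrossedProduct, X.monomial (𝟙 e) 1 * y = y →
      X.monomial (𝟙 e) 1 * z = z →
      X.monomial (τ ≫ σ) 1 * y = X.monomial (τ ≫ σ) 1 * z → y = z := by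
    intro y z hy hz h
    rw [← hy, ← hz, ← monomialInv_mul_monomial X (τ ≫ σ), mul_assoc, h, mul_assoc]
  apply cancel
  · rw [← mul_assoc, id_mul_monomial]
  · rw [← mul_assoc, id_mul_monomialInv]
  · rw [← mul_assoc, ← mul_assoc, monomial_mul_monomialInv, id_mul_monomial, monomial_mul_id,
      one_mul, RingEquiv.apply_symm_apply]
    have : X.monomial (τ ≫ σ) (a * X.β σ τ) = X.monomial σ a * X.monomial τ 1 := by
      rw [monomial_mul, map_one, mul_one]
    rw [this, mul_assoc, monomial_mul_monomialInv, monomial_mul_id, map_one, mul_one]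

variable (Δ : Subgroupoid Γ)

theorem monomial_mem_subringOf {e f : Γ} {σ : e ⟶ f} (hσ : σ ∈ Δ.arrows e f) (a : X.A f) :
    X.monomial σ a ∈ X.subringOf Δ := by
  intro p hp
  refine X.coeff_single_of_ne (p := ⟨e, f, σ⟩) ?_ a
  rintro rfl
  exact hp hσ

/-! ### Sufficiency: Casimir elements and the bimodule section -/

section Casimir

variable {e : Γ} [∀ f, Fintype (e ⟶ f)] (c : X.A e)

/-- The element `∑ u_τ c ⊗ u_τ⁻¹` of `R ⊗_{R_Δ} R`, where `τ` runs over the arrows `e ⟶ f`. -/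
def casimir (f : Γ) : BalancedTensor (X.subringOf Δ) :=
  ∑ τ : e ⟶ f, BalancedTensor.tmul _ (X.monomial τ (X.α τ c)) (X.monomialInv τ)

/-- The translation `τ ↦ στ` matches the summands of `x_f` and `x_g`. -/
theorem lact_casimir (hΔ : Δ.IsWide) (hc : c ∈ Set.center (X.A e)) {f g : Γ} (σ : f ⟶ g)
    (a : X.A g) :
    BalancedTensor.lact _ (X.monomial σ a) (X.casimir Δ c f) =
      BalancedTensor.ract _ (X.monomial σ a) (X.casimir Δ c g) := by
  rw [casimir, casimir, map_sum, map_sum]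
  refine Fintype.sum_equiv
    { toFun := fun τ => τ ≫ σ
      invFun := fun τ => τ ≫ Groupoid.inv σ
      left_inv := fun τ => by simp
      right_inv := fun τ => by simp } _ _ fun τ => ?_
  rw [BalancedTensor.lact_tmul, BalancedTensor.ract_tmul]
  change _ = BalancedTensor.tmul _ (X.monomial (τ ≫ σ) (X.α (τ ≫ σ) c))
    (X.monomialInv (τ ≫ σ) * X.monomial σ a)
  -- The coefficient left over sits on an identity arrow, which lies in `Δ` by wideness, so it may
  -- cross the tensor sign.
  rw [← monomial_mul_monomialInv_comp, ← BalancedTensor.tmul_mul _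
    (X.monomial_mem_subringOf Δ (hΔ.wide e) _), monomial_mul_id, RingEquiv.apply_symm_apply,
    monomial_mul, X.α_α_of_mem_center σ τ hc]
  have h := Semigroup.mem_center_iff.1 (X.α_mem_center (τ ≫ σ) hc)
  rw [h a, mul_assoc]

theorem mulMap_casimir (hconn : ∀ f, Nonempty (e ⟶ f)) (hc : c ∈ Set.center (X.A e))
    (hsum : ∑ g : e ⟶ e, X.α g c = 1) (f : Γ) :
    BalancedTensor.mulMap _ (X.casimir Δ c f) = X.monomial (𝟙 f) 1 := by
  obtain ⟨ρ⟩ := hconn f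
  -- Translating by `ρ`, this sum is `α_ρ` of the trace of `c` over the loops at `e`.
  have key : ∑ τ : e ⟶ f, X.α τ c = 1 := by
    rw [← map_one (X.α ρ), ← hsum, map_sum]
    refine Fintype.sum_equiv
      { toFun := fun τ => τ ≫ Groupoid.inv ρ
        invFun := fun τ => τ ≫ ρ
        left_inv := fun τ => by simp
        right_inv := fun τ => by simp } _ _ fun τ => ?_
    rw [X.α_α_of_mem_center _ _ hc]
    simp
  have hadd : X.monomial (𝟙 f) (∑ τ : e ⟶ f, X.α τ c) =
      ∑ τ : e ⟶ f, X.monomial (𝟙 f) (X.α τ c) :=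
    map_sum (X.single ⟨f, f, 𝟙 f⟩) _ _
  rw [casimir, map_sum, ← key, hadd]
  exact Finset.sum_congr rfl fun τ _ => X.monomial_mul_monomialInv τ _

/-- The map `R → R ⊗_{R_Δ} R` given by `a u_σ ↦ a u_σ x_{d(σ)}`, where `x_f` is `casimir f`. -/
def casimirSection : X.CrossedProduct →+ BalancedTensor (X.subringOf Δ) := by
  classical
  exact DFinsupp.liftAddHom (β := fun p : Arr Γ => X.A p.2.1) fun p =>
    AddMonoidHom.mk' (fun a => BalancedTensor.lact _ (X.single p a) (X.casimir Δ c p.1))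
      fun a a' => by rw [map_add, BalancedTensor.lact_add]

theorem casimirSection_monomial {f g : Γ} (σ : f ⟶ g) (a : X.A g) :
    X.casimirSection Δ c (X.monomial σ a) =
      BalancedTensor.lact _ (X.monomial σ a) (X.casimir Δ c f) := by
  classical
  exact DFinsupp.liftAddHom_apply_single (β := fun p : Arr Γ => X.A p.2.1) _ ⟨f, g, σ⟩ a

end Casimir

/-- If `Γ` is connected with finite isotropy group at `e`, and `A_e` has a central element of
trace `1`, then `R/R_Δ` is separable. -/
theorem isSeparableExtension_of_sum_eq_one (hΔ : Δ.IsWide) {e : Γ} [∀ f, Fintype (e ⟶ f)]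
    (hconn : ∀ f, Nonempty (e ⟶ f)) (c : X.A e) (hc : c ∈ Set.center (X.A e))
    (hsum : ∑ g : e ⟶ e, X.α g c = 1) : IsSeparableExtension (X.subringOf Δ) := by
  refine ⟨X.casimirSection Δ c, fun r x => ?_, fun x r => ?_, fun x => ?_⟩
  · induction x using induction_monomial with
    | h0 => simp
    | ha x y hx hy => rw [mul_add, map_add, map_add, hx, hy, map_add]
    | hs i j τ b =>
      induction r using induction_monomial with
      | h0 => rw [zero_mul, map_zero, BalancedTensor.lact_zero]
      | ha x y hx hy => rw [add_mul, map_add, BalancedTensor.lact_add, hx, hy]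
      | hs i' j' σ a =>
        rw [casimirSection_monomial, ← BalancedTensor.lact_mul]
        by_cases h : j = i'
        · subst h
          rw [monomial_mul, casimirSection_monomial]
        · rw [X.monomial_mul_of_ne _ _ h, map_zero, BalancedTensor.lact_zero]
  · induction x using induction_monomial with
    | h0 => simp
    | ha x y hx hy => rw [add_mul, map_add, map_add, hx, hy, map_add]
    | hs i j τ b =>
      induction r using induction_monomial with
      | h0 => rw [mul_zero, map_zero, BalancedTensor.ract_zero]
      | ha x y hx hy => rw [mul_add, map_add, BalancedTensor.ract_add, hx, hy]
      | hs i' j' σ a =>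
        rw [casimirSection_monomial, X.lact_casimir Δ c hΔ hc, ← BalancedTensor.ract_mul]
        by_cases h : j' = i
        · subst h
          rw [monomial_mul, casimirSection_monomial, X.lact_casimir Δ c hΔ hc]
        · rw [X.monomial_mul_of_ne _ _ h, map_zero, BalancedTensor.ract_zero]
  · induction x using induction_monomial with
    | h0 => simp
    | ha x y hx hy => rw [map_add, map_add, hx, hy]
    | hs i j τ b =>
      rw [casimirSection_monomial, BalancedTensor.mulMap_lact,
        X.mulMap_casimir Δ c hconn hc hsum, monomial_mul_id, map_one, mul_one]

end ObjectCrossedSystem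

/-! ### Elements of trace one in fields -/

/-- A finite family of distinct automorphisms of a field which is permuted by composition with
each of its members has an element of trace `1`. -/
theorem exists_sum_eq_one {F T : Type*} [Field F] [Fintype T] [Nonempty T] (φ : T → F ≃+* F)
    (hφ : Function.Injective φ) (π : T → T ≃ T) (hπ : ∀ g h x, φ g (φ h x) = φ (π g h) x) :
    ∃ c : F, ∑ g, φ g c = 1 := by
  have hinj : Function.Injective fun g : T => ((φ g : F →+* F) : F →* F) := fun g h H =>
    hφ (RingEquiv.ext fun x => DFunLike.congr_fun H x)
  -- A vanishing sum would be a linear relation, with all coefficients `1`, between distinct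
  -- characters.
  have hne : ∑ g, (fun x : F => φ g x) ≠ 0 := by
    intro h0
    have hli := (linearIndependent_monoidHom F F).comp _ hinj
    rw [Fintype.linearIndependent_iff] at hli
    obtain ⟨g⟩ := ‹Nonempty T›
    refine one_ne_zero (hli (fun _ => 1) ?_ g)
    rw [← h0]
    exact Finset.sum_congr rfl fun g _ => one_smul F _
  obtain ⟨a, ha⟩ := Function.ne_iff.1 hne
  rw [Finset.sum_apply, Pi.zero_apply] at ha
  -- The trace of `a` is fixed by every `φ g`, so dividing by it scales the trace to `1`.
  refine ⟨a * (∑ g, φ g a)⁻¹, ?_⟩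
  have hfix : ∀ g, φ g (∑ h, φ h a) = ∑ h, φ h a := fun g => by
    rw [map_sum]
    exact Fintype.sum_equiv (π g) _ _ fun h => hπ g h a
  simp only [map_mul, map_inv₀, hfix]
  rw [← Finset.sum_mul, mul_inv_cancel₀ ha]

/-! ### Isotropy in the groupoid of conjugate fields -/

section Conjugates

variable {K N : Type*} [Field K] [Field N] [Algebra K N] (L : IntermediateField K N)

/-- The field `L` as an object of the groupoid of its conjugates. -/
def ConjField.base : ConjField L := ⟨L, AlgEquiv.refl, (IntermediateField.map_id _).symm⟩

theorem ConjField.nonempty_hom (M : ConjField L) : Nonempty (ConjField.base L ⟶ M) := by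
  obtain ⟨M, g, rfl⟩ := M
  exact ⟨⟨L.equivMap (g : N →ₐ[K] N), g, rfl, fun x => rfl⟩⟩

/-- For `N/K` normal, the isotropy group at `L` consists of all `K`-automorphisms of `L`. -/
def ConjField.loopEquiv [Normal K N] :
    (ConjField.base L ⟶ ConjField.base L) ≃ (L ≃ₐ[K] L) where
  toFun σ := σ.1
  -- Normality of `N/K` extends `s` to `N`; the extension maps `L` onto itself because `s` does.
  invFun s := ⟨s, s.liftNormal N, by
    have h : ∀ x : L, (s x : N) = s.liftNormal N x := fun x =>
      (s.liftNormal_commutes N x).symm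
    refine ⟨?_, h⟩
    refine le_antisymm ?_ fun y hy => ?_
    · rintro _ ⟨x, hx, rfl⟩
      have := h ⟨x, hx⟩
      exact this ▸ (s ⟨x, hx⟩).2
    · obtain ⟨x, hx⟩ := s.surjective ⟨y, hy⟩
      exact ⟨x, x.2, (h x).symm.trans (congrArg Subtype.val hx)⟩⟩
  left_inv _ := rfl
  right_inv _ := rfl

/-- A conjugate of `L` with finite isotropy has an element of trace `1`. -/
theorem ConjFactorSet.exists_sum_eq_one {L : IntermediateField K N} (b : ConjFactorSet L)
    (e : ConjField L) [Fintype (e ⟶ e)] :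
    ∃ c : b.system.A e, c ∈ Set.center (b.system.A e) ∧
      ∑ g : e ⟶ e, b.system.α g c = 1 := by
  have : Nonempty (e ⟶ e) := ⟨𝟙 e⟩
  obtain ⟨c, hc⟩ := _root_.exists_sum_eq_one (F := e.1)
    (fun g : e ⟶ e => (g.1 : e.1 ≃ₐ[K] e.1).toRingEquiv)
    (fun g h H => Subtype.ext (AlgEquiv.ext fun x => RingEquiv.congr_fun H x))
    (fun g =>
      { toFun := fun h => h ≫ g
        invFun := fun h => h ≫ Groupoid.inv g
        left_inv := fun h => by simp
        right_inv := fun h => by simp }) (fun g h x => rfl)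
  exact ⟨c, Semigroup.mem_center_iff.2 fun x => mul_comm (G := e.1) x c, hc⟩

end Conjugates

theorem mainTheorem8 {K Ω : Type*} [Field K] [Field Ω] [Algebra K Ω] [IsAlgClosure K Ω]
    (L : IntermediateField K Ω) [Algebra.IsSeparable K L]
    (b : ConjFactorSet (IntermediateField.restrict (IntermediateField.le_normalClosure L)))
    (Δ : Subgroupoid
      (ConjField (IntermediateField.restrict (IntermediateField.le_normalClosure L))))
    (hwide : Δ.IsWide)
    (htriv : ∀ M, Δ.arrows M M = {𝟙 M}) :
    IsSeparableExtension (b.system.subringOf Δ) ↔ Finite (L ≃ₐ[K] L) := by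
  have : Normal K Ω := IsAlgClosure.normal K Ω
  -- The groupoid is built from the copy of `L` inside its normal closure; `ι` identifies `L` with
  -- that copy.
  let ι := IntermediateField.restrictAlgEquiv (IntermediateField.le_normalClosure L)
  have hiff : Finite (L ≃ₐ[K] L) ↔
      Finite (ConjField.base (IntermediateField.restrict (IntermediateField.le_normalClosure L)) ⟶
        ConjField.base _) :=
    ((AlgEquiv.autCongr ι).toEquiv.trans (ConjField.loopEquiv _).symm).finite_iff
  rw [hiff]
  refine ⟨fun h => b.system.finite_isotropy_of_isSeparableExtension Δ hwide htriv h _,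
    fun h => ?_⟩
  let _ := fun M => @Fintype.ofFinite _
    (ObjectCrossedSystem.finite_hom_of_finite_isotropy (ConjField.base
      (IntermediateField.restrict (IntermediateField.le_normalClosure L))) M)
  obtain ⟨c, hc, hsum⟩ := b.exists_sum_eq_one (ConjField.base _)
  exact b.system.isSeparableExtension_of_sum_eq_one Δ hwide (ConjField.nonempty_hom _) c hc hsum

end
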